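/- For a finite simple graph $G$ with vertex set $V(G)$, let $S(G)$ be the set of real symmetric matrices $A=(a_{uv})$, with rows and columns indexed by $V(G)$, such that for all $u\ne v$ one has $a_{uv}\neq 0$ if and only if $\{u,v\}$ is an edge of $G$ (the diagonal entries are arbitrary). Let $q(A)$ be the number of distinct eigenvalues of $A$, and let $q(G)=\min\{q(A) : A\in S(G)\}$. Theorem. Let $G$ be a connected graph on $n=|V(G)|\le 5$ vertices. Then $q(G)=|V(G)|-1$ if and only if $G$ is isomorphic to one of the following graphs: (a) the graph with vertices $v_1,\dots,v_n$ and edge set $\{\{v_1,v_2\},\{v_2,v_3\},\dots,\{v_{n-1},v_n\},\{v_i,v_{i+2}\}\}$ for some $i$ with $1\le i\le n-2$; (b) the graph with vertices $v_1,\dots,v_n$ and edge set $\{\{v_1,v_2\},\{v_2,v_3\},\dots,\{v_{n-2},v_{n-1}\},\{v_i,v_n\}\}$ for some $i$ with $2\le i\le n-2$. -/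

import Mathlib

/-- `S(G)`: the real symmetric matrices, indexed by the vertices of `G`, whose off-diagonal
entries are nonzero exactly at the edges of `G`; the diagonal entries are arbitrary. -/
def SymMatricesOf {V : Type*} (G : SimpleGraph V) : Set (Matrix V V ℝ) :=
  {A | A.IsSymm ∧ ∀ i j, i ≠ j → (A i j ≠ 0 ↔ G.Adj i j)}

/-- `q(A)`: the number of distinct (real) eigenvalues of a real square matrix `A`. It is only
used for symmetric `A`, all of whose eigenvalues are real. -/
noncomputable def numDistinctEigenvalues {V : Type*} [Fintype V] [DecidableEq V]
    (A : Matrix V V ℝ) : ℕ :=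
  {μ : ℝ | Module.End.HasEigenvalue (Matrix.toLin' A) μ}.ncard

/-- The family `S(G)` is nonempty (it contains the adjacency matrix). -/
theorem symMatricesOf_nonempty {V : Type*} (G : SimpleGraph V) :
    (SymMatricesOf G).Nonempty := by
  classical
  exact ⟨G.adjMatrix ℝ, G.isSymm_adjMatrix, fun i j _ => by simp [SimpleGraph.adjMatrix_apply]⟩

/-- `q(G)`: the minimum of `q(A)` over all `A` in `S(G)`. -/
noncomputable def minDistinctEigenvalues {V : Type*} [Fintype V] [DecidableEq V]
    (G : SimpleGraph V) : ℕ :=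
  sInf (numDistinctEigenvalues '' SymMatricesOf G)

/-- The graph on `v_1, …, v_n` with edges `{v_1, v_2}, …, {v_{n-1}, v_n}` and `{v_i, v_{i+2}}`.
The element `a` of `Fin n` stands for the vertex `v_{a+1}`; used for `1 ≤ i ≤ n - 2`. -/
def pathWithChord (n i : ℕ) : SimpleGraph (Fin n) :=
  SimpleGraph.fromRel fun a b =>
    a.val + 1 = b.val ∨ (a.val + 1 = i ∧ b.val + 1 = i + 2)

/-- The graph on `v_1, …, v_n` with edges `{v_1, v_2}, …, {v_{n-2}, v_{n-1}}` and `{v_i, v_n}`.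
The element `a` of `Fin n` stands for the vertex `v_{a+1}`; used for `2 ≤ i ≤ n - 2`. -/
def pathWithPendant (n i : ℕ) : SimpleGraph (Fin n) :=
  SimpleGraph.fromRel fun a b =>
    (a.val + 1 = b.val ∧ b.val + 1 < n) ∨ (a.val + 1 = i ∧ b.val + 1 = n)

/-! For a real symmetric matrix, `q(A)` is the least degree of a monic polynomial annihilating `A`.
This gives two tools. Above, one integer matrix in `S(G)` and one monic integer polynomial killing
it bound `q(G)` (`minDistinctEigenvalues_le_length`). Below, a unique shortest path with `d + 1`
vertices forces `q(G) ≥ d + 1` (`length_le_minDistinctEigenvalues`): the top power of `A` has a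
nonzero entry where all lower powers vanish.

A path on `n` vertices is its own unique shortest path, so `q = n`. Each graph of the two families
has a unique shortest path on `n - 1` vertices and a matrix attaining that bound. Every other
connected graph on at most five vertices has a matrix with at most `n - 2` distinct eigenvalues.
That the list of graphs is complete is a kernel computation on graphs coded as bit masks
(`exists_nonempty_iso_of_isoClosure_eq`). -/

/-! ### Distinct eigenvalues and annihilating polynomials. -/

open Polynomial in
theorem numDistinctEigenvalues_le_natDegree {V : Type*} [Fintype V] [DecidableEq V]
    {A : Matrix V V ℝ} {p : ℝ[X]} (hp : p ≠ 0) (h : aeval A p = 0) :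
    numDistinctEigenvalues A ≤ p.natDegree := by
  have hsub : {μ : ℝ | Module.End.HasEigenvalue (Matrix.toLin' A) μ} ⊆ p.roots.toFinset := by
    intro μ hμ
    obtain ⟨v, hv⟩ := Module.End.HasEigenvalue.exists_hasEigenvector hμ
    have h1 := Module.End.aeval_apply_of_hasEigenvector (p := p) hv
    have h2 : aeval (Matrix.toLin' A) p = 0 := by
      have := Polynomial.aeval_algHom_apply (Matrix.toLinAlgEquiv' (R := ℝ) (n := V)) A p
      rw [h, map_zero] at this
      exact this
    rw [h2, LinearMap.zero_apply] at h1
    have h3 : p.eval μ = 0 := (smul_eq_zero.mp h1.symm).resolve_right hv.2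
    simpa [hp] using h3
  calc _ ≤ (p.roots.toFinset : Set ℝ).ncard := Set.ncard_le_ncard hsub (Finset.finite_toSet _)
    _ = p.roots.toFinset.card := Set.ncard_coe_finset _
    _ ≤ p.roots.card := Multiset.toFinset_card_le _
    _ ≤ _ := Polynomial.card_roots' p

-- The product of `X - μ` over the distinct eigenvalues kills an orthonormal eigenbasis, hence kills
-- `A`.
open Polynomial in
theorem exists_monic_aeval_eq_zero {V : Type*} [Fintype V] [DecidableEq V]
    {A : Matrix V V ℝ} (hA : A.IsSymm) :
    ∃ p : ℝ[X], p.Monic ∧ p.natDegree = numDistinctEigenvalues A ∧ aeval A p = 0 := by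
  have hH : A.IsHermitian := by
    rw [Matrix.IsHermitian, Matrix.conjTranspose_eq_transpose_of_trivial]
    exact hA
  have hfin : {μ : ℝ | Module.End.HasEigenvalue (Matrix.toLin' A) μ}.Finite :=
    Module.End.finite_hasEigenvalue _
  refine ⟨∏ μ ∈ hfin.toFinset, (X - C μ), monic_prod_X_sub_C _ _, ?_, ?_⟩
  · rw [natDegree_prod_of_monic _ _ fun _ _ => monic_X_sub_C _]
    simp [numDistinctEigenvalues, Set.ncard_eq_toFinset_card _ hfin]
  · set p := ∏ μ ∈ hfin.toFinset, (X - C μ) with hp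
    have key : ∀ j, (aeval A p).mulVec (hH.eigenvectorBasis j) = 0 := by
      intro j
      have hev : Module.End.HasEigenvector (Matrix.toLin' A) (hH.eigenvalues j)
          (WithLp.ofLp (hH.eigenvectorBasis j)) := by
        refine ⟨Module.End.mem_eigenspace_iff.mpr ?_, ?_⟩
        · rw [Matrix.toLin'_apply]
          exact hH.mulVec_eigenvectorBasis j
        · intro h0
          exact hH.eigenvectorBasis.orthonormal.ne_zero j (by ext i; exact congrFun h0 i)
      have h1 := Module.End.aeval_apply_of_hasEigenvector (p := p) hev
      have h2 : aeval (Matrix.toLin' A) p = Matrix.toLin' (aeval A p) :=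
        Polynomial.aeval_algHom_apply (Matrix.toLinAlgEquiv' (R := ℝ) (n := V)) A p
      have h3 : p.eval (hH.eigenvalues j) = 0 := by
        rw [hp, eval_prod]
        refine Finset.prod_eq_zero (i := hH.eigenvalues j) ?_ (by simp)
        simpa using Module.End.hasEigenvalue_of_hasEigenvector hev
      rw [h2, h3, zero_smul, Matrix.toLin'_apply] at h1
      exact h1
    have hlin : Matrix.toEuclideanLin (aeval A p) = 0 := by
      refine hH.eigenvectorBasis.toBasis.ext fun j => ?_
      ext i
      simpa using congrFun (key j) i
    exact Matrix.toEuclideanLin.map_eq_zero_iff.mp hlin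

theorem numDistinctEigenvalues_submatrix_equiv {V W : Type*} [Fintype V] [DecidableEq V]
    [Fintype W] [DecidableEq W] (e : W ≃ V) (A : Matrix V V ℝ) :
    numDistinctEigenvalues (A.submatrix e e) = numDistinctEigenvalues A := by
  unfold numDistinctEigenvalues
  congr 1
  ext μ
  simp only [Set.mem_ofPred_eq, Module.End.hasEigenvalue_iff_isRoot_charpoly,
    Matrix.charpoly_toLin']
  rw [← Matrix.charpoly_reindex e.symm A]
  rfl

theorem minDistinctEigenvalues_le_of_mem {V : Type*} [Fintype V] [DecidableEq V]
    {G : SimpleGraph V} {A : Matrix V V ℝ} (hA : A ∈ SymMatricesOf G) :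
    minDistinctEigenvalues G ≤ numDistinctEigenvalues A :=
  Nat.sInf_le ⟨A, hA, rfl⟩

theorem exists_numDistinctEigenvalues_eq {V : Type*} [Fintype V] [DecidableEq V]
    (G : SimpleGraph V) :
    ∃ A ∈ SymMatricesOf G, numDistinctEigenvalues A = minDistinctEigenvalues G :=
  Nat.sInf_mem ((symMatricesOf_nonempty G).image _)

theorem minDistinctEigenvalues_le_of_iso {V W : Type*} [Fintype V] [DecidableEq V]
    [Fintype W] [DecidableEq W] {G : SimpleGraph V} {H : SimpleGraph W} (e : G ≃g H) :
    minDistinctEigenvalues G ≤ minDistinctEigenvalues H := by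
  obtain ⟨A, ⟨hs, hA⟩, h⟩ := exists_numDistinctEigenvalues_eq H
  rw [← h, ← numDistinctEigenvalues_submatrix_equiv e.toEquiv]
  refine minDistinctEigenvalues_le_of_mem ⟨hs.submatrix _, fun i j hij => ?_⟩
  rw [← e.map_adj_iff]
  exact hA _ _ (e.injective.ne hij)

theorem minDistinctEigenvalues_congr {V W : Type*} [Fintype V] [DecidableEq V]
    [Fintype W] [DecidableEq W] {G : SimpleGraph V} {H : SimpleGraph W} (e : G ≃g H) :
    minDistinctEigenvalues G = minDistinctEigenvalues H :=
  (minDistinctEigenvalues_le_of_iso e).antisymm (minDistinctEigenvalues_le_of_iso e.symm)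

/-! ### Upper bounds from integer certificates. -/

-- The fold is Horner's rule; started at a monic polynomial it never changes the leading
-- coefficient.
open Polynomial in
theorem exists_monic_aeval_eq_foldl {R : Type*} [Ring R] [Algebra ℝ R] (A : R) (l : List ℤ)
    (p : ℝ[X]) (hp : p.Monic) :
    ∃ q : ℝ[X], q.Monic ∧ q.natDegree = p.natDegree + l.length ∧
      aeval A q = l.foldl (fun (M : R) (c : ℤ) => A * M + (c : R)) (aeval A p) := by
  induction l generalizing p with
  | nil => exact ⟨p, hp, rfl, rfl⟩
  | cons c l ih =>
    have hd : (X * p).natDegree = p.natDegree + 1 := by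
      rw [natDegree_X_mul hp.ne_zero]
    have hlt : (C (c : ℝ)).degree < (X * p).degree := by
      refine degree_C_le.trans_lt ?_
      rw [← natDegree_pos_iff_degree_pos]; omega
    have hm : (X * p + C (c : ℝ)).Monic := (monic_X.mul hp).add_of_left hlt
    obtain ⟨q, hq, hdq, ha⟩ := ih (X * p + C (c : ℝ)) hm
    refine ⟨q, hq, ?_, ?_⟩
    · rw [hdq, natDegree_add_C, hd, List.length_cons]; omega
    · rw [ha]; simp

/-- Whether the integer matrix `A` belongs to `S(G)` and is annihilated by the monic polynomial with
lower coefficients `l`, highest first. -/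
def IsAnnihilatedInSymMatricesOf {V : Type*} [Fintype V] [DecidableEq V] (G : SimpleGraph V)
    (A : Matrix V V ℤ) (l : List ℤ) : Prop :=
  A.IsSymm ∧ (∀ i j, i ≠ j → (A i j ≠ 0 ↔ G.Adj i j)) ∧
    l.foldl (fun (M : Matrix V V ℤ) c => A * M + Matrix.diagonal fun _ => c) 1 = 0

instance {V : Type*} [Fintype V] [DecidableEq V] (G : SimpleGraph V) [DecidableRel G.Adj]
    (A : Matrix V V ℤ) (l : List ℤ) : Decidable (IsAnnihilatedInSymMatricesOf G A l) :=
  haveI : ∀ i, Decidable (∀ j, i ≠ j → (A i j ≠ 0 ↔ G.Adj i j)) := fun _ => inferInstance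
  inferInstanceAs (Decidable (A.transpose = A ∧ _ ∧ _))

/-- Makes upper bounds decidable: the annihilating polynomial can have integer coefficients even
when the eigenvalues are irrational. -/
theorem minDistinctEigenvalues_le_length {V : Type*} [Fintype V] [DecidableEq V]
    {G : SimpleGraph V} (A : Matrix V V ℤ) (l : List ℤ)
    (hAl : IsAnnihilatedInSymMatricesOf G A l) :
    minDistinctEigenvalues G ≤ l.length := by
  obtain ⟨hs, hA, h⟩ := hAl
  let f : Matrix V V ℤ →+* Matrix V V ℝ := (Int.castRingHom ℝ).mapMatrix
  obtain ⟨q, hq, hd, ha⟩ := exists_monic_aeval_eq_foldl (f A) l 1 Polynomial.monic_one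
  have hfold : ∀ M : Matrix V V ℤ,
      l.foldl (fun (M : Matrix V V ℝ) (c : ℤ) => f A * M + (c : Matrix V V ℝ)) (f M) =
      f (l.foldl (fun M c => A * M + Matrix.diagonal fun _ => c) M) := by
    clear h ha hd
    induction l with
    | nil => intro M; rfl
    | cons c l ih =>
      intro M
      rw [List.foldl_cons, List.foldl_cons, ← ih, map_add, map_mul]
      congr 2
      exact (map_intCast f c).symm
  rw [map_one, ← map_one f, hfold, h, map_zero] at ha
  have hmem : f A ∈ SymMatricesOf G := by
    refine ⟨?_, fun i j hij => ?_⟩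
    · ext i j
      simp [f, hs.apply i j]
    · rw [← hA i j hij]
      simp [f]
  calc _ ≤ numDistinctEigenvalues (f A) := minDistinctEigenvalues_le_of_mem hmem
    _ ≤ q.natDegree := numDistinctEigenvalues_le_natDegree hq.ne_zero ha
    _ = _ := by rw [hd]; simp

/-! ### Lower bounds from unique shortest paths. -/

/-- If the levels `ℓ` bound the distance to `p 0` from below and `p` is a path climbing one level
at a time, each of whose vertices has its predecessor as only neighbour of lower level, then `q(G)`
is at least the number of vertices of `p`. -/
theorem length_le_minDistinctEigenvalues {V : Type*} [Fintype V] [DecidableEq V]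
    {G : SimpleGraph V} {d : ℕ} (ℓ : V → ℕ) (p : Fin (d + 1) → V) (hp : ∀ k, ℓ (p k) = k)
    (hℓ : ∀ u v, G.Adj u v → ℓ v ≤ ℓ u + 1)
    (hadj : ∀ k : Fin d, G.Adj (p k.castSucc) (p k.succ))
    (huniq : ∀ (k : Fin d) u, G.Adj u (p k.succ) → ℓ u ≤ k → u = p k.castSucc) :
    d + 1 ≤ minDistinctEigenvalues G := by
  obtain ⟨A, ⟨hs, hA⟩, hq⟩ := exists_numDistinctEigenvalues_eq G
  obtain ⟨f, hf, hdeg, hann⟩ := exists_monic_aeval_eq_zero hs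
  rw [← hq]
  by_contra! hlt
  have hzero : ∀ k v, k < ℓ v → (A ^ k) (p 0) v = 0 := by
    intro k
    induction k with
    | zero =>
      intro v hv
      rw [pow_zero, Matrix.one_apply_ne]
      rintro rfl
      simp [hp] at hv
    | succ k ih =>
      intro v hv
      rw [pow_succ, Matrix.mul_apply]
      refine Finset.sum_eq_zero fun u _ => ?_
      by_cases hu : k < ℓ u
      · rw [ih u hu, zero_mul]
      · have huv : u ≠ v := by rintro rfl; omega
        have : ¬ G.Adj u v := fun h => by have := hℓ u v h; omega
        rw [← hA u v huv, not_not] at this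
        rw [this, mul_zero]
  -- Only one walk of length `k` leads from `p 0` to `p k`, so this entry is a product of nonzero
  -- edge entries.
  have hne : ∀ k : Fin (d + 1), (A ^ (k : ℕ)) (p 0) (p k) ≠ 0 := by
    intro k
    induction k using Fin.induction with
    | zero => simp
    | succ k ih =>
      rw [Fin.val_succ, pow_succ, Matrix.mul_apply, Finset.sum_eq_single (p k.castSucc)]
      · exact mul_ne_zero ih ((hA _ _ (hadj k).ne).mpr (hadj k))
      · intro u _ hu
        by_cases hk : (k : ℕ) < ℓ u
        · rw [hzero _ _ hk, zero_mul]
        · have huv : u ≠ p k.succ := by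
            rintro rfl
            simp [hp] at hk
          have : ¬ G.Adj u (p k.succ) := fun h => hu (huniq k u h (not_lt.mp hk))
          rw [← hA _ _ huv, not_not] at this
          rw [this, mul_zero]
      · simp
  have hlast := hne (Fin.last d)
  have hle : f.natDegree ≤ d := by omega
  -- A power of `X` pads `f` to degree exactly `d`; at the entry `(p 0, p d)` only the leading term
  -- survives.
  have h1 : (Polynomial.aeval A (Polynomial.X ^ (d - f.natDegree) * f)) (p 0) (p (Fin.last d))
      = 0 := by
    rw [map_mul, hann, mul_zero, Matrix.zero_apply]
  have hm : (Polynomial.X ^ (d - f.natDegree) * f).Monic := (Polynomial.monic_X_pow _).mul hf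
  have hnd : (Polynomial.X ^ (d - f.natDegree) * f).natDegree = d := by
    rw [(Polynomial.monic_X_pow _).natDegree_mul hf, Polynomial.natDegree_X_pow]; omega
  rw [Polynomial.aeval_eq_sum_range, hnd, Finset.sum_range_succ, Matrix.add_apply,
    Matrix.sum_apply, Finset.sum_eq_zero, zero_add] at h1
  · have hc := hm.coeff_natDegree
    rw [hnd] at hc
    rw [hc, one_smul] at h1
    exact hlast (by simpa using h1)
  · intro k hk
    rw [Matrix.smul_apply, hzero _ _ (by simpa [hp] using hk), smul_zero]

/-! ### Graphs on at most five vertices as bit masks. -/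

/-- Numbering of the unordered pairs of distinct naturals: `01, 02, 12, 03, 13, 23, …`. -/
def pairCode (i j : ℕ) : ℕ :=
  bif Nat.blt i j then j * (j - 1) / 2 + i else i * (i - 1) / 2 + j

/-- The pairs `i < j < n`. -/
def orderedPairs (n : ℕ) : List (ℕ × ℕ) :=
  (List.range n).flatMap fun j => (List.range j).map fun i => (i, j)

/-- The permutations of `0, …, n - 1` as lists of values. -/
def permLists : ℕ → List (List ℕ)
  | 0 => [[]]
  | n + 1 => (permLists n).flatMap fun l => (List.range (n + 1)).map fun i => l.insertIdx i n

/-- The natural number with the given binary digits set. -/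
def bitset (l : List ℕ) : ℕ :=
  l.foldr (fun x s => s ||| 1 <<< x) 0

/-- The code of the image under `p` of the graph on `n` vertices with code `c`. -/
def relabel (n c : ℕ) (p : List ℕ) : ℕ :=
  bitset (((orderedPairs n).filter fun e => c.testBit (pairCode e.1 e.2)).map fun e =>
    pairCode (p.getD e.1 0) (p.getD e.2 0))

/-- The set, as a bit set, of the codes of the graphs isomorphic to one coded in `cs`. -/
def isoClosure (n : ℕ) (cs : List ℕ) : ℕ :=
  cs.foldr (fun c s => s ||| bitset ((permLists n).map (relabel n c))) 0

theorem pairCode_comm {i j : ℕ} (h : i ≠ j) : pairCode i j = pairCode j i := by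
  rcases lt_or_gt_of_ne h with h | h
  · have h1 : Nat.blt i j = true := by simpa using h
    have h2 : Nat.blt j i = false := by
      rw [Bool.eq_false_iff, ne_eq, Nat.blt_eq]
      exact h.le.not_gt
    simp [pairCode, h1, h2]
  · have h1 : Nat.blt j i = true := by simpa using h
    have h2 : Nat.blt i j = false := by
      rw [Bool.eq_false_iff, ne_eq, Nat.blt_eq]
      exact h.le.not_gt
    simp [pairCode, h1, h2]

theorem pairCode_lt : ∀ n ≤ 5, ∀ i j : Fin n, i ≠ j → pairCode i j < n * (n - 1) / 2 := by
  decide +kernel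

theorem pairCode_inj : ∀ n ≤ 5, ∀ i j : Fin n, i ≠ j → ∀ a b : Fin n, a ≠ b →
    pairCode i j = pairCode a b → (i = a ∧ j = b) ∨ (i = b ∧ j = a) := by
  intro n hn
  interval_cases n <;> decide +kernel

theorem getD_mem_permLists : ∀ n ≤ 5, ∀ p ∈ permLists n, ∀ i : Fin n, p.getD i 0 < n ∧
    ∀ j : Fin n, p.getD i 0 = p.getD j 0 → i = j := by
  decide +kernel

theorem testBit_bitset (l : List ℕ) (k : ℕ) : (bitset l).testBit k = true ↔ k ∈ l := by
  induction l with
  | nil => simp [bitset]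
  | cons x l ih =>
    have : bitset (x :: l) = bitset l ||| 1 <<< x := rfl
    rw [this, Nat.testBit_or, Bool.or_eq_true, ih, Nat.one_shiftLeft, Nat.testBit_two_pow]
    simp [or_comm, eq_comm]

/-- The graph on `n` vertices whose edges are given by the binary digits of `m`. -/
def maskGraph (n m : ℕ) : SimpleGraph (Fin n) where
  Adj i j := i ≠ j ∧ m.testBit (pairCode i j) = true
  symm := ⟨fun i j h => ⟨h.1.symm, by rw [pairCode_comm (Fin.val_ne_of_ne h.1.symm)]; exact h.2⟩⟩
  loopless := ⟨fun _ h => h.1 rfl⟩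

instance (n m : ℕ) : DecidableRel (maskGraph n m).Adj := fun i j =>
  inferInstanceAs (Decidable (i ≠ j ∧ m.testBit (pairCode i j) = true))

theorem exists_eq_maskGraph {n : ℕ} (hn : n ≤ 5) (G : SimpleGraph (Fin n)) :
    ∃ m < 2 ^ (n * (n - 1) / 2), G = maskGraph n m := by
  classical
  refine ⟨Nat.ofBits fun k : Fin (n * (n - 1) / 2) =>
    decide (∃ i j : Fin n, i ≠ j ∧ pairCode i j = k ∧ G.Adj i j), Nat.ofBits_lt_two_pow _, ?_⟩
  ext i j
  by_cases hij : i = j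
  · simp [hij]
  · have hlt := pairCode_lt n hn i j hij
    change _ ↔ i ≠ j ∧ _
    rw [Nat.testBit_ofBits_lt _ _ hlt, decide_eq_true_iff]
    refine ⟨fun h => ⟨hij, i, j, hij, rfl, h⟩, ?_⟩
    rintro ⟨-, a, b, hab, hc, h⟩
    rcases pairCode_inj n hn a b hab i j hij hc with ⟨rfl, rfl⟩ | ⟨rfl, rfl⟩
    · exact h
    · exact h.symm

theorem mem_orderedPairs {n : ℕ} {e : ℕ × ℕ} : e ∈ orderedPairs n ↔ e.1 < e.2 ∧ e.2 < n := by
  simp only [orderedPairs, List.mem_flatMap, List.mem_range, List.mem_map]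
  constructor
  · rintro ⟨j, hj, i, hi, rfl⟩
    exact ⟨hi, hj⟩
  · rintro ⟨h1, h2⟩
    exact ⟨e.2, h2, e.1, h1, rfl⟩

/-- Only soundness of relabelling is needed; that `permLists` misses no permutation is never used.
-/
theorem nonempty_iso_relabel {n : ℕ} (hn : n ≤ 5) (c : ℕ) {p : List ℕ} (hp : p ∈ permLists n) :
    Nonempty (maskGraph n c ≃g maskGraph n (relabel n c p)) := by
  have H := getD_mem_permLists n hn p hp
  let f : Fin n → Fin n := fun i => ⟨p.getD i 0, (H i).1⟩
  have hf : Function.Injective f := fun i j h => (H i).2 j (congrArg Fin.val h)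
  refine ⟨⟨Equiv.ofBijective f (Finite.injective_iff_bijective.mp hf), ?_⟩⟩
  intro i j
  change (f i ≠ f j ∧ _) ↔ (i ≠ j ∧ _)
  rw [hf.ne_iff]
  refine and_congr_right fun hij => ?_
  rw [Equiv.ofBijective_apply, Equiv.ofBijective_apply, relabel, testBit_bitset]
  simp only [List.mem_map, List.mem_filter, mem_orderedPairs]
  constructor
  · rintro ⟨⟨a, b⟩, ⟨⟨hab, hb⟩, hc⟩, h⟩
    have key := pairCode_inj n hn (f ⟨a, hab.trans hb⟩) (f ⟨b, hb⟩)
      (hf.ne (by simpa using hab.ne)) (f i) (f j) (hf.ne hij) h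
    rw [hf.eq_iff, hf.eq_iff, hf.eq_iff, hf.eq_iff] at key
    rcases key with ⟨rfl, rfl⟩ | ⟨rfl, rfl⟩
    · exact hc
    · rw [pairCode_comm hab.ne']; exact hc
  · intro hc
    rcases lt_or_gt_of_ne hij with h | h
    · exact ⟨(i, j), ⟨⟨h, j.2⟩, hc⟩, rfl⟩
    · refine ⟨(j, i), ⟨⟨h, i.2⟩, ?_⟩, pairCode_comm (Fin.val_ne_of_ne (hf.ne hij.symm))⟩
      rw [pairCode_comm (Fin.val_ne_of_ne hij.symm)]
      exact hc

/-- The right side of `h` has a one at every mask below `2 ^ (n * (n - 1) / 2)`, so every graph is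
reached from `cs`. -/
theorem exists_nonempty_iso_of_isoClosure_eq {n : ℕ} (hn : n ≤ 5) {cs : List ℕ}
    (h : isoClosure n cs = 2 ^ 2 ^ (n * (n - 1) / 2) - 1) (G : SimpleGraph (Fin n)) :
    ∃ c ∈ cs, Nonempty (G ≃g maskGraph n c) := by
  obtain ⟨m, hm, rfl⟩ := exists_eq_maskGraph hn G
  have hbit : (isoClosure n cs).testBit m = true := by
    rw [h, Nat.testBit_two_pow_sub_one, decide_eq_true hm]
  clear h
  induction cs with
  | nil => simp [isoClosure] at hbit
  | cons c cs ih =>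
    have hcons : isoClosure n (c :: cs) =
      isoClosure n cs ||| bitset ((permLists n).map (relabel n c)) := rfl
    rw [hcons, Nat.testBit_or, Bool.or_eq_true, testBit_bitset, List.mem_map] at hbit
    rcases hbit with hbit | ⟨p, hp, rfl⟩
    · obtain ⟨c', hc', e⟩ := ih hbit
      exact ⟨c', List.mem_cons_of_mem _ hc', e⟩
    · exact ⟨c, List.mem_cons_self, (nonempty_iso_relabel hn c hp).map fun e => e.symm⟩

theorem not_connected_of_closed {V : Type*} {G : SimpleGraph V} (s : Finset V)
    (hs : ∀ u v, G.Adj u v → u ∈ s → v ∈ s) (h1 : ∃ u, u ∈ s) (h2 : ∃ v, v ∉ s) :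
    ¬ G.Connected := by
  intro hG
  obtain ⟨u, hu⟩ := h1
  obtain ⟨v, hv⟩ := h2
  obtain ⟨w⟩ := hG.preconnected u v
  induction w with
  | nil => exact hv hu
  | cons h _ ih => exact ih (hs _ _ h hu) hv

instance (n i : ℕ) : DecidableRel (pathWithChord n i).Adj := fun a b =>
  decidable_of_iff _ (SimpleGraph.fromRel_adj _ a b).symm

instance (n i : ℕ) : DecidableRel (pathWithPendant n i).Adj := fun a b =>
  decidable_of_iff _ (SimpleGraph.fromRel_adj _ a b).symm

/-! ### Matrices with at most `n - 2` distinct eigenvalues. -/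

/-- The masks code the 4-cycle, the 4-cycle with a chord, and the complete graph. -/
theorem minDistinctEigenvalues_maskGraph_four_le :
    ∀ c ∈ [30, 31, 63],
      minDistinctEigenvalues (maskGraph 4 c) ≤ 2 := by
  intro c hc
  fin_cases hc
  · exact minDistinctEigenvalues_le_length
      !![0, 0, 1, 1; 0, 0, -1, 1; 1, -1, -1, 0; 1, 1, 0, -1]
      [1, -2] (by decide +kernel)
  · exact minDistinctEigenvalues_le_length
      !![0, 1, 1, 1; 1, 0, 1, -1; 1, 1, -1, 0; 1, -1, 0, 1]
      [0, -3] (by decide +kernel)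
  · exact minDistinctEigenvalues_le_length
      !![1, 1, 1, 1; 1, 1, 1, 1; 1, 1, 1, 1; 1, 1, 1, 1]
      [-4, 0] (by decide +kernel)

theorem minDistinctEigenvalues_maskGraph_five_le :
    ∀ c ∈ [109, 615, 125, 111, 997, 79, 613, 222, 223, 75, 591, 127, 254, 1005, 1020, 1022, 1023],
      minDistinctEigenvalues (maskGraph 5 c) ≤ 3 := by
  intro c hc
  fin_cases hc
  · exact minDistinctEigenvalues_le_length
      !![0, -1, 0, 1, 3; -1, 2, 2, 0, 0; 0, 2, -3, 2, 0; 1, 0, 2, 2, 0; 3, 0, 0, 0, -2]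
      [0, -15, 14] (by decide +kernel)
  · exact minDistinctEigenvalues_le_length
      !![0, 1, -1, 0, 1; 1, 0, 1, 0, 0; -1, 1, 0, 1, 0; 0, 0, 1, -1, 1; 1, 0, 0, 1, -1]
      [1, -3, 0] (by decide +kernel)
  · exact minDistinctEigenvalues_le_length
      !![0, 1, 0, -1, 1; 1, 1, 1, 1, 0; 0, 1, -1, 1, 0; -1, 1, 1, 1, 0; 1, 0, 0, 0, 2]
      [-2, -3, 4] (by decide +kernel)
  · exact minDistinctEigenvalues_le_length
      !![0, 1, 2, 2, 2; 1, -1, 2, 0, 0; 2, 2, -1, 3, 0; 2, 0, 3, 0, 0; 2, 0, 0, 0, -3]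
      [0, -22, -15] (by decide +kernel)
  · exact minDistinctEigenvalues_le_length
      !![0, 2, 0, 0, -1; 2, 2, 2, 0, 1; 0, 2, 2, 2, 1; 0, 0, 2, 0, -1; -1, 1, 1, -1, 1]
      [-5, -4, 20] (by decide +kernel)
  · exact minDistinctEigenvalues_le_length
      !![0, 1, 1, 1, 1; 1, -1, 1, 0, 0; 1, 1, -1, 0, 0; 1, 0, 0, 0, 0; 1, 0, 0, 0, 0]
      [0, -4, 0] (by decide +kernel)
  · exact minDistinctEigenvalues_le_length
      !![0, 1, 0, 0, 1; 1, 0, 1, 0, 0; 0, 1, 0, 1, 0; 0, 0, 1, 0, 1; 1, 0, 0, 1, 0]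
      [-1, -3, 2] (by decide +kernel)
  · exact minDistinctEigenvalues_le_length
      !![0, 0, 1, 1, 1; 0, 0, 1, 1, 1; 1, 1, 0, 0, 0; 1, 1, 0, 0, 0; 1, 1, 0, 0, 0]
      [0, -6, 0] (by decide +kernel)
  · exact minDistinctEigenvalues_le_length
      !![0, 1, 1, 1, 1; 1, 0, 1, 1, 1; 1, 1, -1, 0, 0; 1, 1, 0, -1, 0; 1, 1, 0, 0, -1]
      [1, -7, -7] (by decide +kernel)
  · exact minDistinctEigenvalues_le_length
      !![0, 1, 1, 1, 1; 1, 0, 0, 0, 0; 1, 0, 0, 0, 0; 1, 0, 0, 0, 0; 1, 0, 0, 0, 0]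
      [0, -4, 0] (by decide +kernel)
  · exact minDistinctEigenvalues_le_length
      !![0, 1, -1, -1, 1; 1, 1, 1, 0, 0; -1, 1, 1, 0, 0; -1, 0, 0, 1, 1; 1, 0, 0, 1, 1]
      [0, -4, 0] (by decide +kernel)
  · exact minDistinctEigenvalues_le_length
      !![0, 1, 1, 1, 1; 1, 1, 1, 1, 0; 1, 1, 1, 1, 0; 1, 1, 1, 1, 0; 1, 0, 0, 0, -1]
      [-2, -7, 0] (by decide +kernel)
  · exact minDistinctEigenvalues_le_length
      !![0, 0, 1, 1, 1; 0, 0, 1, 1, 1; 1, 1, 1, 1, 0; 1, 1, 1, 1, 0; 1, 1, 0, 0, -1]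
      [-1, -8, 0] (by decide +kernel)
  · exact minDistinctEigenvalues_le_length
      !![0, 1, 0, 1, 1; 1, 0, 1, 0, -1; 0, 1, 0, 1, 1; 1, 0, 1, 0, -1; 1, -1, 1, -1, 1]
      [1, -6, 0] (by decide +kernel)
  · exact minDistinctEigenvalues_le_length
      !![0, 0, 0, -1, 1; 0, 1, -1, 1, 1; 0, -1, -1, 1, 1; -1, 1, 1, -1, 1; 1, 1, 1, 1, -1]
      [0, -6, 4] (by decide +kernel)
  · exact minDistinctEigenvalues_le_length
      !![0, 0, 1, 1, 1; 0, 0, 1, 1, 1; 1, 1, -1, 1, 1; 1, 1, 1, -1, 1; 1, 1, 1, 1, -1]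
      [-1, -6, 0] (by decide +kernel)
  · exact (minDistinctEigenvalues_le_length
      !![1, 1, 1, 1, 1; 1, 1, 1, 1, 1; 1, 1, 1, 1, 1; 1, 1, 1, 1, 1; 1, 1, 1, 1, 1]
      [-5, 0] (by decide +kernel)).trans (by decide)

/-! ### The value `n - 1` on the two families. -/

/-- The levels are distances from `v_1`; the unique shortest path to the farthest vertex used takes
the chord and skips `v_{i+1}`. -/
theorem minDistinctEigenvalues_pathWithChord {n i : ℕ} (hn : n ≤ 5)
    (hi : 1 ≤ i) (hin : i + 2 ≤ n) :
    minDistinctEigenvalues (pathWithChord n i) + 1 = n := by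
  have h : (n, i) ∈ [(3, 1), (4, 1), (4, 2), (5, 1), (5, 2), (5, 3)] := by
    simp only [List.mem_cons, Prod.mk.injEq, List.not_mem_nil, or_false]
    omega
  simp only [List.mem_cons, Prod.mk.injEq, List.not_mem_nil, or_false] at h
  rcases h with ⟨rfl, rfl⟩ | ⟨rfl, rfl⟩ | ⟨rfl, rfl⟩ | ⟨rfl, rfl⟩ | ⟨rfl, rfl⟩ | ⟨rfl, rfl⟩
  · exact congrArg (· + 1) (le_antisymm
      (minDistinctEigenvalues_le_length
        !![1, 1, 1; 1, 1, 1; 1, 1, 1]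
        [-3, 0] (by decide +kernel))
      (length_le_minDistinctEigenvalues (d := 1) ![0, 1, 1]
        ![0, 2] (by decide) (by decide) (by decide) (by decide)))
  · exact congrArg (· + 1) (le_antisymm
      (minDistinctEigenvalues_le_length
        !![0, 1, 1, 0; 1, 0, 1, 0; 1, 1, 1, 1; 0, 0, 1, 0]
        [-2, -2, 1] (by decide +kernel))
      (length_le_minDistinctEigenvalues (d := 2) ![0, 1, 1, 2]
        ![0, 2, 3] (by decide) (by decide) (by decide) (by decide)))
  · exact congrArg (· + 1) (le_antisymm
      (minDistinctEigenvalues_le_length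
        !![0, 1, 0, 0; 1, 1, 1, 1; 0, 1, 0, 1; 0, 1, 1, 0]
        [-2, -2, 1] (by decide +kernel))
      (length_le_minDistinctEigenvalues (d := 2) ![0, 1, 2, 2]
        ![0, 1, 3] (by decide) (by decide) (by decide) (by decide)))
  · exact congrArg (· + 1) (le_antisymm
      (minDistinctEigenvalues_le_length
        !![0, 1, 1, 0, 0; 1, 0, -1, 0, 0; 1, -1, 0, 1, 0; 0, 0, 1, 0, 1; 0, 0, 0, 1, 1]
        [0, -5, 1, 3] (by decide +kernel))
      (length_le_minDistinctEigenvalues (d := 3) ![0, 1, 1, 2, 3]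
        ![0, 2, 3, 4] (by decide) (by decide) (by decide) (by decide)))
  · exact congrArg (· + 1) (le_antisymm
      (minDistinctEigenvalues_le_length
        !![0, 1, 0, 0, 0; 1, 1, 1, 1, 0; 0, 1, 0, 1, 0; 0, 1, 1, 1, 1; 0, 0, 0, 1, 0]
        [-3, -1, 3, 0] (by decide +kernel))
      (length_le_minDistinctEigenvalues (d := 3) ![0, 1, 2, 2, 3]
        ![0, 1, 3, 4] (by decide) (by decide) (by decide) (by decide)))
  · exact congrArg (· + 1) (le_antisymm
      (minDistinctEigenvalues_le_length
        !![1, 1, 0, 0, 0; 1, 0, 1, 0, 0; 0, 1, 0, 1, 1; 0, 0, 1, 0, -1; 0, 0, 1, -1, 0]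
        [0, -5, 1, 3] (by decide +kernel))
      (length_le_minDistinctEigenvalues (d := 3) ![0, 1, 2, 3, 3]
        ![0, 1, 2, 4] (by decide) (by decide) (by decide) (by decide)))

/-- Here the unique shortest path is `v_1, …, v_{n-1}`, without the pendant vertex. -/
theorem minDistinctEigenvalues_pathWithPendant {n i : ℕ} (hn : n ≤ 5)
    (hi : 2 ≤ i) (hin : i + 2 ≤ n) :
    minDistinctEigenvalues (pathWithPendant n i) + 1 = n := by
  have h : (n, i) ∈ [(4, 2), (5, 2), (5, 3)] := by
    simp only [List.mem_cons, Prod.mk.injEq, List.not_mem_nil, or_false]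
    omega
  simp only [List.mem_cons, Prod.mk.injEq, List.not_mem_nil, or_false] at h
  rcases h with ⟨rfl, rfl⟩ | ⟨rfl, rfl⟩ | ⟨rfl, rfl⟩
  · exact congrArg (· + 1) (le_antisymm
      (minDistinctEigenvalues_le_length
        !![0, 1, 0, 0; 1, 0, 1, 1; 0, 1, 0, 0; 0, 1, 0, 0]
        [0, -3, 0] (by decide +kernel))
      (length_le_minDistinctEigenvalues (d := 2) ![0, 1, 2, 2]
        ![0, 1, 2] (by decide) (by decide) (by decide) (by decide)))
  · exact congrArg (· + 1) (le_antisymm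
      (minDistinctEigenvalues_le_length
        !![0, 1, 0, 0, 0; 1, 1, 1, 0, 1; 0, 1, 1, 1, 0; 0, 0, 1, 1, 0; 0, 1, 0, 0, 0]
        [-3, -1, 5, 0] (by decide +kernel))
      (length_le_minDistinctEigenvalues (d := 3) ![0, 1, 2, 3, 2]
        ![0, 1, 2, 3] (by decide) (by decide) (by decide) (by decide)))
  · exact congrArg (· + 1) (le_antisymm
      (minDistinctEigenvalues_le_length
        !![1, 1, 0, 0, 0; 1, 1, 1, 0, 0; 0, 1, 1, 1, 1; 0, 0, 1, 0, 0; 0, 0, 1, 0, 0]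
        [-3, -1, 5, 0] (by decide +kernel))
      (length_le_minDistinctEigenvalues (d := 3) ![0, 1, 2, 3, 3]
        ![0, 1, 2, 3] (by decide) (by decide) (by decide) (by decide)))

/-! ### Classification of the connected graphs. -/

theorem card_le_minDistinctEigenvalues_path {n m : ℕ}
    (h : (n, m) ∈ [(0, 0), (1, 1), (2, 5), (3, 37), (4, 549)]) :
    n + 1 ≤ minDistinctEigenvalues (maskGraph (n + 1) m) := by
  refine length_le_minDistinctEigenvalues (d := n) (fun v => v) id (fun _ => rfl) ?_ ?_ ?_ <;>
    simp only [List.mem_cons, Prod.mk.injEq, List.not_mem_nil, or_false] at h <;>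
    rcases h with ⟨rfl, rfl⟩ | ⟨rfl, rfl⟩ | ⟨rfl, rfl⟩ | ⟨rfl, rfl⟩ | ⟨rfl, rfl⟩ <;> decide +kernel

theorem nonempty_iso_of_forall_adj_iff {n : ℕ} {G H : SimpleGraph (Fin n)}
    (h : ∀ i j, G.Adj i j ↔ H.Adj i j) : Nonempty (G ≃g H) :=
  ⟨⟨Equiv.refl _, fun {i j} => (h i j).symm⟩⟩

/-- The two families of graphs of the theorem, on `n` vertices. -/
def IsPathWithExtraEdge {V : Type*} (n : ℕ) (G : SimpleGraph V) : Prop :=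
  (∃ i : ℕ, 1 ≤ i ∧ i + 2 ≤ n ∧ Nonempty (G ≃g pathWithChord n i)) ∨
    ∃ i : ℕ, 2 ≤ i ∧ i + 2 ≤ n ∧ Nonempty (G ≃g pathWithPendant n i)

theorem IsPathWithExtraEdge.of_iso {V W : Type*} {n : ℕ} {G : SimpleGraph V} {H : SimpleGraph W}
    (e : G ≃g H) : IsPathWithExtraEdge n H → IsPathWithExtraEdge n G := by
  rintro (⟨i, h1, h2, ⟨f⟩⟩ | ⟨i, h1, h2, ⟨f⟩⟩)
  · exact Or.inl ⟨i, h1, h2, ⟨e.trans f⟩⟩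
  · exact Or.inr ⟨i, h1, h2, ⟨e.trans f⟩⟩

/-- Reversing the path identifies chord `i` with `n - 1 - i` and pendant `i` with `n - i`, which
leaves six graphs. -/
theorem isPathWithExtraEdge_maskGraph {n c : ℕ}
    (h : (n, c) ∈ [(3, 7), (4, 39), (4, 21), (5, 551), (5, 565), (5, 165)]) :
    IsPathWithExtraEdge n (maskGraph n c) := by
  simp only [List.mem_cons, Prod.mk.injEq, List.not_mem_nil, or_false] at h
  rcases h with ⟨rfl, rfl⟩ | ⟨rfl, rfl⟩ | ⟨rfl, rfl⟩ | ⟨rfl, rfl⟩ | ⟨rfl, rfl⟩ | ⟨rfl, rfl⟩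
  · exact Or.inl ⟨1, by decide, by decide, nonempty_iso_of_forall_adj_iff (by decide +kernel)⟩
  · exact Or.inl ⟨1, by decide, by decide, nonempty_iso_of_forall_adj_iff (by decide +kernel)⟩
  · exact Or.inr ⟨2, by decide, by decide, nonempty_iso_of_forall_adj_iff (by decide +kernel)⟩
  · exact Or.inl ⟨1, by decide, by decide, nonempty_iso_of_forall_adj_iff (by decide +kernel)⟩
  · exact Or.inl ⟨2, by decide, by decide, nonempty_iso_of_forall_adj_iff (by decide +kernel)⟩
  · exact Or.inr ⟨2, by decide, by decide, nonempty_iso_of_forall_adj_iff (by decide +kernel)⟩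

theorem not_connected_of_exists_closed {n : ℕ} {cs : List ℕ} (h : ∀ c ∈ cs,
    ∃ s : Finset (Fin n), (∃ u, u ∈ s) ∧ (∃ v, v ∉ s) ∧
      ∀ u ∈ s, ∀ v, (maskGraph n c).Adj u v → v ∈ s) {c : ℕ} (hc : c ∈ cs) :
    ¬ (maskGraph n c).Connected := by
  obtain ⟨s, hu, hv, hs⟩ := h c hc
  exact not_connected_of_closed s (fun u v huv hu => hs u hu v huv) hu hv

theorem exists_iso_maskGraph_of_connected {n : ℕ} (hn : n ≤ 5) {cs ds : List ℕ}
    (h : isoClosure n (cs ++ ds) = 2 ^ 2 ^ (n * (n - 1) / 2) - 1)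
    (hd : ∀ c ∈ ds, ∃ s : Finset (Fin n), (∃ u, u ∈ s) ∧ (∃ v, v ∉ s) ∧
      ∀ u ∈ s, ∀ v, (maskGraph n c).Adj u v → v ∈ s)
    {G : SimpleGraph (Fin n)} (hG : G.Connected) : ∃ c ∈ cs, Nonempty (G ≃g maskGraph n c) := by
  obtain ⟨c, hc, ⟨e⟩⟩ := exists_nonempty_iso_of_isoClosure_eq hn h G
  rcases List.mem_append.mp hc with hc | hc
  · exact ⟨c, hc, ⟨e⟩⟩
  · exact absurd (e.connected_iff.mp hG) (not_connected_of_exists_closed hd hc)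

theorem minDistinctEigenvalues_ne_of_connected {n : ℕ} (hn : n ≤ 5) {G : SimpleGraph (Fin n)}
    (hG : G.Connected) :
    minDistinctEigenvalues G + 1 ≠ n ∨ IsPathWithExtraEdge n G := by
  have path : ∀ k m, (k, m) ∈ [(0, 0), (1, 1), (2, 5), (3, 37), (4, 549)] →
      minDistinctEigenvalues (maskGraph (k + 1) m) + 1 ≠ k + 1 := fun k m h => by
    have := card_le_minDistinctEigenvalues_path h
    omega
  suffices ∃ m, Nonempty (G ≃g maskGraph n m) ∧
      (minDistinctEigenvalues (maskGraph n m) + 1 ≠ n ∨ IsPathWithExtraEdge n (maskGraph n m)) by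
    obtain ⟨m, ⟨e⟩, h⟩ := this
    exact h.imp (fun h => minDistinctEigenvalues_congr e ▸ h) (IsPathWithExtraEdge.of_iso e)
  interval_cases n
  · obtain ⟨v⟩ := hG.nonempty
    exact v.elim0
  · obtain ⟨c, hc, e⟩ := exists_iso_maskGraph_of_connected (cs := [0]) (ds := []) (by decide)
      (by decide +kernel) (by decide) hG
    fin_cases hc
    exact ⟨_, e, Or.inl (path 0 0 (by decide))⟩
  · obtain ⟨c, hc, e⟩ := exists_iso_maskGraph_of_connected (cs := [1]) (ds := [0]) (by decide)
      (by decide +kernel) (by decide +kernel) hG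
    fin_cases hc
    exact ⟨_, e, Or.inl (path 1 1 (by decide))⟩
  · obtain ⟨c, hc, e⟩ := exists_iso_maskGraph_of_connected (cs := [5, 7]) (ds := [0, 1])
      (by decide) (by decide +kernel) (by decide +kernel) hG
    fin_cases hc
    · exact ⟨_, e, Or.inl (path 2 5 (by decide))⟩
    · exact ⟨_, e, Or.inr (isPathWithExtraEdge_maskGraph (by decide))⟩
  · obtain ⟨c, hc, e⟩ := exists_iso_maskGraph_of_connected
      (cs := [30, 31, 63] ++ [37, 39, 21]) (ds := [0, 1, 3, 7, 12])
      (by decide) (by decide +kernel) (by decide +kernel) hG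
    rcases List.mem_append.mp hc with hc | hc
    · have := minDistinctEigenvalues_maskGraph_four_le c hc
      exact ⟨c, e, Or.inl (by omega)⟩
    fin_cases hc
    · exact ⟨_, e, Or.inl (path 3 37 (by decide))⟩
    all_goals exact ⟨_, e, Or.inr (isPathWithExtraEdge_maskGraph (by decide))⟩
  -- `cs` lists the 17 graphs with `q ≤ 3`, then the path and the three family members; `ds` lists
  -- the disconnected graphs.
  · obtain ⟨c, hc, e⟩ := exists_iso_maskGraph_of_connected
      (cs := [109, 615, 125, 111, 997, 79, 613, 222, 223, 75, 591, 127, 254, 1005, 1020, 1022,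
        1023] ++ [549, 551, 565, 165])
      (ds := [0, 1, 3, 7, 11, 12, 13, 15, 30, 31, 63, 76, 116])
      (by decide) (by decide +kernel) (by decide +kernel) hG
    rcases List.mem_append.mp hc with hc | hc
    · have := minDistinctEigenvalues_maskGraph_five_le c hc
      exact ⟨c, e, Or.inl (by omega)⟩
    fin_cases hc
    · exact ⟨_, e, Or.inl (path 4 549 (by decide))⟩
    all_goals exact ⟨_, e, Or.inr (isPathWithExtraEdge_maskGraph (by decide))⟩

theorem theorem7p6 {V : Type*} [Fintype V] [DecidableEq V] (G : SimpleGraph V)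
    (hG : G.Connected) (hcard : Fintype.card V ≤ 5) :
    minDistinctEigenvalues G + 1 = Fintype.card V ↔
      (∃ i : ℕ, 1 ≤ i ∧ i + 2 ≤ Fintype.card V ∧
        Nonempty (G ≃g pathWithChord (Fintype.card V) i)) ∨
      (∃ i : ℕ, 2 ≤ i ∧ i + 2 ≤ Fintype.card V ∧
        Nonempty (G ≃g pathWithPendant (Fintype.card V) i)) := by
  constructor
  · intro h
    let e := SimpleGraph.Iso.map (Fintype.equivFin V) G
    rcases minDistinctEigenvalues_ne_of_connected hcard (e.connected_iff.mp hG) with h' | h'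
    · rw [minDistinctEigenvalues_congr e] at h
      exact absurd h h'
    · exact h'.of_iso e
  · rintro (⟨i, h1, h2, ⟨e⟩⟩ | ⟨i, h1, h2, ⟨e⟩⟩)
    · rw [minDistinctEigenvalues_congr e]
      exact minDistinctEigenvalues_pathWithChord hcard h1 h2
    · rw [minDistinctEigenvalues_congr e]
      exact minDistinctEigenvalues_pathWithPendant hcard h1 h2
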